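/- Let $G$ be a connected (real, finite-dimensional) Lie group, let $\Gamma$ be a discrete (not necessarily cocompact) subgroup of $H = PSL(2,\mathbb{R}) \times G$, and let $p_1 : H \to PSL(2,\mathbb{R})$ and $p_2 : H \to G$ be the two projections. Let $B$ be the subgroup of $PSL(2,\mathbb{R})$ consisting of the classes of the matrices $\begin{pmatrix} \lambda & t \\ 0 & \lambda^{-1} \end{pmatrix}$ with $\lambda > 0$ and $t \in \mathbb{R}$. Any subgroup $F$ of $PSL(2,\mathbb{R})$ acts on the right on the left quotient $X = \Gamma \backslash H$ by $\Gamma(f,g)\cdot f' = \Gamma(ff',g)$. An action on a topological space is called minimal if all its orbits are dense. Then the right $B$-action on $X$ is minimal if and only if the following two properties hold: (i) $p_1(\Gamma)$ acts minimally by left translations on $PSL(2,\mathbb{R})/B$; (ii) $p_2(\Gamma)$ is dense in $G$, or equivalently, the right $PSL(2,\mathbb{R})$-action on $X$ is minimal. -/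

import Mathlib

open scoped MatrixGroups Manifold ContDiff

/-- The subgroup of `SL(2, ℝ)` of all matrices `!![l, t; 0, l⁻¹]` with `l > 0` and `t` real. -/
def borelSL : Subgroup SL(2, ℝ) where
  carrier := {A | ∃ l t : ℝ, 0 < l ∧ (A : Matrix (Fin 2) (Fin 2) ℝ) = !![l, t; 0, l⁻¹]}
  mul_mem' := by
    rintro A A' ⟨l, t, hl, hA⟩ ⟨l', t', hl', hA'⟩
    refine ⟨l * l', l * t' + t * l'⁻¹, mul_pos hl hl', ?_⟩
    rw [Matrix.SpecialLinearGroup.coe_mul, hA, hA']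
    ext i j
    fin_cases i <;> fin_cases j <;> simp [Matrix.mul_apply, Fin.sum_univ_two, mul_comm]
  one_mem' := by
    refine ⟨1, 0, one_pos, ?_⟩
    ext i j
    fin_cases i <;> fin_cases j <;> simp
  inv_mem' := by
    rintro A ⟨l, t, hl, hA⟩
    refine ⟨l⁻¹, -t, inv_pos.mpr hl, ?_⟩
    rw [Matrix.SpecialLinearGroup.coe_inv, hA, Matrix.adjugate_fin_two_of]
    simp

/-- The subgroup `B` of `PSL(2, ℝ)`: the image of `borelSL` under `SL(2, ℝ) → PSL(2, ℝ)`. -/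
def borelPSL : Subgroup PSL(2, ℝ) :=
  borelSL.map (QuotientGroup.mk' (Subgroup.center SL(2, ℝ)))

/-- The left quotient `X = Γ \ (PSL(2, ℝ) × G)`: two elements are identified when they lie in the
same coset `Γ h`. -/
def LeftQuot {G : Type*} [Group G] (Γ : Subgroup (PSL(2, ℝ) × G)) : Type _ :=
  Quotient (QuotientGroup.rightRel Γ)

namespace LeftQuot

variable {G : Type*} [Group G] {Γ : Subgroup (PSL(2, ℝ) × G)}

/-- The class `Γ h` of `h` in the left quotient. -/
def mk (Γ : Subgroup (PSL(2, ℝ) × G)) (h : PSL(2, ℝ) × G) : LeftQuot Γ :=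
  Quotient.mk (QuotientGroup.rightRel Γ) h

/-- The left quotient carries the quotient topology. -/
instance [TopologicalSpace G] : TopologicalSpace (LeftQuot Γ) :=
  inferInstanceAs (TopologicalSpace (Quotient (QuotientGroup.rightRel Γ)))

/-- The right action `Γ (f, g) · a = Γ (f a, g)` of `PSL(2, ℝ)` on the left quotient, as an action
of the opposite group. A subgroup `F` of `PSL(2, ℝ)` acts by restriction, through `F.op`. -/
instance : MulAction PSL(2, ℝ)ᵐᵒᵖ (LeftQuot Γ) where
  smul a := Quotient.map (fun h => (h.1 * a.unop, h.2)) (by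
    intro x y hxy
    have h1 : y * x⁻¹ ∈ Γ := QuotientGroup.rightRel_apply.mp hxy
    refine QuotientGroup.rightRel_apply.mpr ?_
    convert h1 using 1
    ext <;> simp [mul_assoc])
  one_smul x := by
    induction x using Quotient.inductionOn with
    | h h => exact congrArg (mk Γ) (Prod.ext (mul_one h.1) rfl)
  mul_smul a b x := by
    induction x using Quotient.inductionOn with
    | h h => exact congrArg (mk Γ) (Prod.ext (mul_assoc h.1 b.unop a.unop).symm rfl)

theorem op_smul_mk (a f : PSL(2, ℝ)) (g : G) :
    MulOpposite.op a • mk Γ (f, g) = mk Γ (f * a, g) := rfl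

end LeftQuot

/-! Minimality of `B` on `X` means that every nonempty closed `D ⊆ H`, invariant under `Γ` on the
left and `B` on the right, is `H`. Necessity of (i) and (ii) follows by projecting dense sets.

For sufficiency, let `(q, x) ∈ D` with `G` nontrivial, hence without isolated points. By (ii),
elements of `Γ` tend to infinity while their `G`-components tend to 1. By discreteness their `PSL(2,
ℝ)`-components diverge, so after rescaling they converge to a matrix `T` of rank one: on the
projective line `PSL(2, ℝ)/B` they push everything except the point `ker T` to the point `im T`
(`exists_tendsto_toPSL`). So `D` contains `(im T, y)` whenever it contains some `(ξ, y)` with `ξ ≠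
ker T`. Connectedness of `G` makes such `y` dense (`Subgroup.dense_snd_of_smul_notMem`), so `D`
contains the whole fibre over `im T`, and (i) spreads this fibre over `H` (`eq_univ_of_forall_mem`).
-/

open scoped MatrixGroups Manifold ContDiff
open Filter Topology

/-! ### Subgroups with dense projection to a connected group -/

section DenseProjection

variable {K G : Type*} [Group K] [Group G] [TopologicalSpace G] [IsTopologicalGroup G]

/-- In a connected group, a subgroup with dense projection is generated, up to its subgroup `S`,
by the elements projecting near the identity. -/
theorem Subgroup.le_of_dense_map_snd_of_nhds_one [ConnectedSpace G] {Γ S : Subgroup (K × G)}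
    (hd : Dense (Γ.map (MonoidHom.snd K G) : Set G)) {W : Set G} (hW : W ∈ 𝓝 (1 : G))
    (h : ∀ γ ∈ Γ, γ.2 ∈ W → γ ∈ S) : Γ ≤ S := by
  set N := ((Γ ⊓ S).map (MonoidHom.snd K G)).topologicalClosure with hN
  -- A closed subgroup containing a neighbourhood of 1 is clopen, hence everything by connectedness.
  have hWN : interior W ⊆ N := by
    refine (hd.open_subset_closure_inter isOpen_interior).trans (_root_.closure_mono ?_)
    rintro _ ⟨hx, γ, hγ, rfl⟩
    exact ⟨γ, ⟨hγ, h γ hγ (interior_subset hx)⟩, rfl⟩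
  have hNo : IsOpen (N : Set G) :=
    N.isOpen_of_mem_nhds (mem_of_superset (interior_mem_nhds.mpr hW) hWN)
  have hNu : (N : Set G) = Set.univ :=
    IsClopen.eq_univ ⟨Subgroup.isClosed_topologicalClosure _, hNo⟩ ⟨1, N.one_mem⟩
  intro γ hγ
  have hmem : γ.2 ∈ _root_.closure (((Γ ⊓ S).map (MonoidHom.snd K G) : Subgroup G) : Set G) := by
    have : γ.2 ∈ (N : Set G) := hNu ▸ Set.mem_univ _
    exact this
  have hnhds : {y : G | γ.2 * y⁻¹ ∈ W} ∈ 𝓝 γ.2 := by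
    have hc : ContinuousAt (fun y : G => γ.2 * y⁻¹) γ.2 := by fun_prop
    exact hc (by simpa using hW)
  obtain ⟨_, hy, δ, ⟨hδΓ, hδS⟩, rfl⟩ := _root_.mem_closure_iff_nhds.mp hmem _ hnhds
  have := S.mul_mem (h (γ * δ⁻¹) (Γ.mul_mem hγ (Γ.inv_mem hδΓ)) hy) hδS
  simpa using this

/-- If density failed on an open `V`, all elements over `V` would send `ξ` to the same point.
Comparing `δ` and `δ * γ`, both over `V`, shows that elements over a neighbourhood of 1 fix `ξ`; by
connectedness all of `Γ` would. -/
theorem Subgroup.dense_snd_of_smul_notMem [ConnectedSpace G] {Γ : Subgroup (K × G)}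
    (hd : Dense (Γ.map (MonoidHom.snd K G) : Set G)) {α : Type*} [MulAction K α] {Z : Set α}
    (hZ : Z.Subsingleton) {ξ : α} (hξ : ∃ γ ∈ Γ, γ.1 • ξ ≠ ξ) :
    Dense {k : G | ∃ f : K, (f, k) ∈ Γ ∧ f • ξ ∉ Z} := by
  by_contra hnd
  obtain ⟨V, hVo, hVne, hV⟩ : ∃ V : Set G, IsOpen V ∧ V.Nonempty ∧
      ¬ (V ∩ {k : G | ∃ f : K, (f, k) ∈ Γ ∧ f • ξ ∉ Z}).Nonempty := by
    rw [dense_iff_inter_open] at hnd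
    push Not at hnd
    obtain ⟨V, h1, h2, h3⟩ := hnd
    exact ⟨V, h1, h2, by rw [h3]; simp⟩
  have hV' : ∀ γ ∈ Γ, γ.2 ∈ V → γ.1 • ξ ∈ Z := fun γ hγ hγV => by
    by_contra hc
    exact hV ⟨γ.2, hγV, γ.1, hγ, hc⟩
  obtain ⟨_, hδV, δ, hδ, rfl⟩ := hd.inter_open_nonempty V hVo hVne
  have hW : {w : G | δ.2 * w ∈ V} ∈ 𝓝 (1 : G) := by
    have hc : ContinuousAt (fun w : G => δ.2 * w) 1 := by fun_prop
    exact hc (by simpa using hVo.mem_nhds hδV)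
  have hle : Γ ≤ (MulAction.stabilizer K ξ).comap (MonoidHom.fst K G) := by
    refine Subgroup.le_of_dense_map_snd_of_nhds_one hd hW fun γ hγ hγW => ?_
    have h1 := hV' (δ * γ) (Γ.mul_mem hδ hγ) hγW
    have h2 := hV' δ hδ hδV
    have h3 := hZ h1 h2
    rw [Prod.fst_mul, mul_smul] at h3
    exact MulAction.injective _ h3
  obtain ⟨γ, hγ, hne⟩ := hξ
  exact hne (hle hγ)

end DenseProjection

/-- The elements of a discrete subgroup do not accumulate at any point of the ambient group. -/
theorem Subgroup.not_tendsto_of_discreteTopology {H : Type*} [Group H] [TopologicalSpace H]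
    [IsTopologicalGroup H] (Γ : Subgroup H) [DiscreteTopology Γ] {l : Filter Γ} [l.NeBot]
    (hl : l ≤ cofinite) (h : H) : ¬ Tendsto (fun γ : Γ => (γ : H)) l (𝓝 h) := by
  intro ht
  obtain ⟨W, hW, hWΓ⟩ : ∃ W ∈ 𝓝 (1 : H), ∀ γ ∈ Γ, γ ∈ W → γ = 1 := by
    have h1 : {(1 : Γ)} ∈ 𝓝 (1 : Γ) := by simp [nhds_discrete]
    rw [nhds_subtype_eq_comap] at h1
    obtain ⟨W, hW, hsub⟩ := h1
    refine ⟨W, hW, fun γ hγ hγW => ?_⟩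
    have : (⟨γ, hγ⟩ : Γ) ∈ ({1} : Set Γ) := hsub hγW
    simpa using this
  -- A Cauchy argument: quotients of two late terms lie in `W`, so the terms coincide, against `l ≤
  -- cofinite`.
  have h2 : Tendsto (fun p : Γ × Γ => (p.1 : H) * (p.2 : H)⁻¹) (l ×ˢ l) (𝓝 1) := by
    simpa using (ht.comp tendsto_fst).mul (ht.comp tendsto_snd).inv
  obtain ⟨t, ht, hts⟩ := mem_prod_same_iff.mp (h2 hW)
  obtain ⟨γ, hγ⟩ := l.nonempty_of_mem ht
  have h3 : t ∩ {γ}ᶜ ∈ l := inter_mem ht (hl (by simp))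
  obtain ⟨δ, hδ, hδγ⟩ := l.nonempty_of_mem h3
  have h4 : (δ * γ⁻¹ : H) ∈ W := hts (Set.mk_mem_prod hδ hγ)
  have h5 := hWΓ _ (Γ.mul_mem δ.2 (Γ.inv_mem γ.2)) h4
  exact hδγ (Subtype.ext (mul_inv_eq_one.mp h5))

/-! ### `PSL(2, ℝ)/B` as the projective line -/

section ProjectiveLine

/-- The class of a matrix in `PSL(2, ℝ)`. -/
abbrev toPSL : SL(2, ℝ) →* PSL(2, ℝ) := QuotientGroup.mk' (Subgroup.center SL(2, ℝ))

theorem continuous_toPSL : Continuous toPSL := continuous_quot_mk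

theorem toPSL_surjective : Function.Surjective toPSL := QuotientGroup.mk'_surjective _

theorem toPSL_neg (A : SL(2, ℝ)) : toPSL (-A) = toPSL A := by
  refine (QuotientGroup.eq.mpr ?_).symm
  rw [Matrix.SpecialLinearGroup.mem_center_iff]
  refine ⟨-1, by simp, ?_⟩
  rw [mul_neg, inv_mul_cancel]
  ext i j
  fin_cases i <;> fin_cases j <;> simp

/-- Cosets of `borelPSL` are determined by the direction of the first column. -/
theorem toPSL_coset_eq {A A' : SL(2, ℝ)} (h : A 0 0 * A' 1 0 = A 1 0 * A' 0 0) :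
    (toPSL A : PSL(2, ℝ) ⧸ borelPSL) = toPSL A' := by
  rw [QuotientGroup.eq, ← map_inv, ← map_mul]
  set M := A⁻¹ * A' with hM
  have h10 : M 1 0 = 0 := by
    simp only [hM, Matrix.SpecialLinearGroup.coe_mul, Matrix.SpecialLinearGroup.coe_inv,
      Matrix.adjugate_fin_two, Matrix.mul_apply, Fin.sum_univ_two]
    simp
    linarith
  have hdet : M 0 0 * M 1 1 = 1 := by
    have := M.det_coe
    rw [Matrix.det_fin_two, h10] at this
    linarith
  have key : ∀ N : SL(2, ℝ), N 1 0 = 0 → N 0 0 * N 1 1 = 1 → 0 < N 0 0 →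
      toPSL N ∈ borelPSL := by
    intro N h1 h2 h3
    refine ⟨N, ⟨N 0 0, N 0 1, h3, ?_⟩, rfl⟩
    ext i j
    fin_cases i <;> fin_cases j <;> simp [h1, eq_inv_of_mul_eq_one_right h2]
  -- `borelSL` requires a positive diagonal; passing to `PSL(2, ℝ)` absorbs the sign.
  rcases lt_trichotomy (M 0 0) 0 with h0 | h0 | h0
  · rw [← toPSL_neg]
    exact key (-M) (by simp [h10]) (by simpa using hdet) (by simpa using h0)
  · simp [h0] at hdet
  · exact key M h10 hdet h0

/-- A matrix of determinant one with a prescribed nonzero first column. -/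
noncomputable def withFirstColumn (w : {w : Fin 2 → ℝ // 0 < w 0 ^ 2 + w 1 ^ 2}) : SL(2, ℝ) :=
  ⟨!![w.1 0, -(w.1 1) / (w.1 0 ^ 2 + w.1 1 ^ 2); w.1 1, w.1 0 / (w.1 0 ^ 2 + w.1 1 ^ 2)], by
    have := w.2.ne'
    rw [Matrix.det_fin_two_of]
    field_simp
    ring⟩

theorem withFirstColumn_apply_zero_zero (w : {w : Fin 2 → ℝ // 0 < w 0 ^ 2 + w 1 ^ 2}) :
    withFirstColumn w 0 0 = w.1 0 := rfl

theorem withFirstColumn_apply_one_zero (w : {w : Fin 2 → ℝ // 0 < w 0 ^ 2 + w 1 ^ 2}) :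
    withFirstColumn w 1 0 = w.1 1 := rfl

theorem continuous_withFirstColumn : Continuous withFirstColumn := by
  refine continuous_induced_rng.mpr (continuous_matrix fun i j => ?_)
  have h0 : Continuous fun w : {w : Fin 2 → ℝ // 0 < w 0 ^ 2 + w 1 ^ 2} => w.1 0 :=
    (continuous_apply 0).comp continuous_subtype_val
  have h1 : Continuous fun w : {w : Fin 2 → ℝ // 0 < w 0 ^ 2 + w 1 ^ 2} => w.1 1 :=
    (continuous_apply 1).comp continuous_subtype_val
  have hs := (h0.pow 2).add (h1.pow 2)
  fin_cases i <;> fin_cases j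
  · exact h0
  · exact h1.neg.div hs fun w => w.2.ne'
  · exact h1
  · exact h0.div hs fun w => w.2.ne'

/-- The first column of the product of a matrix with an element of `SL(2, ℝ)`. -/
def mulFirstColumn (T : Matrix (Fin 2) (Fin 2) ℝ) (A : SL(2, ℝ)) : Fin 2 → ℝ :=
  fun i => T i 0 * A 0 0 + T i 1 * A 1 0

/-- Rescaling does not change the direction of a column, so the cosets of `F i * A` follow the first
column of `c i • F i * A`, which converges to a nonzero vector. The continuous section
`withFirstColumn` lifts this to convergent representatives. -/
theorem exists_tendsto_toPSL {ι : Type*} {l : Filter ι} {F : ι → SL(2, ℝ)} {c : ι → ℝ}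
    {T : Matrix (Fin 2) (Fin 2) ℝ} (hT : Tendsto (fun i => c i • (F i : Matrix _ _ ℝ)) l (𝓝 T))
    (A : SL(2, ℝ)) (hA : 0 < mulFirstColumn T A 0 ^ 2 + mulFirstColumn T A 1 ^ 2) :
    ∃ P : ι → SL(2, ℝ), Tendsto P l (𝓝 (withFirstColumn ⟨mulFirstColumn T A, hA⟩)) ∧
      ∀ᶠ i in l, (toPSL (P i) : PSL(2, ℝ) ⧸ borelPSL) = toPSL (F i * A) := by
  classical
  set w : ι → Fin 2 → ℝ := fun i => mulFirstColumn (c i • (F i : Matrix _ _ ℝ)) A with hw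
  have hent : ∀ a b, Tendsto (fun i => (c i • (F i : Matrix _ _ ℝ)) a b) l (𝓝 (T a b)) :=
    fun a b => ((continuous_id.matrix_elem a b).tendsto T).comp hT
  have hlim : Tendsto w l (𝓝 (mulFirstColumn T A)) :=
    tendsto_pi_nhds.mpr fun a =>
      ((hent a 0).mul_const _).add ((hent a 1).mul_const _)
  have hev : ∀ᶠ i in l, 0 < w i 0 ^ 2 + w i 1 ^ 2 := by
    have hc : Continuous fun v : Fin 2 → ℝ => v 0 ^ 2 + v 1 ^ 2 := by fun_prop
    exact ((hc.tendsto _).comp hlim).eventually_const_lt hA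
  set w' : ι → {w : Fin 2 → ℝ // 0 < w 0 ^ 2 + w 1 ^ 2} := fun i =>
    if h : 0 < w i 0 ^ 2 + w i 1 ^ 2 then ⟨w i, h⟩ else ⟨mulFirstColumn T A, hA⟩ with hw'
  have hlim' : Tendsto w' l (𝓝 ⟨mulFirstColumn T A, hA⟩) := by
    rw [tendsto_subtype_rng]
    refine hlim.congr' ?_
    filter_upwards [hev] with i hi
    simp [hw', hi]
  refine ⟨fun i => withFirstColumn (w' i), (continuous_withFirstColumn.tendsto _).comp hlim', ?_⟩
  filter_upwards [hev] with i hi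
  apply toPSL_coset_eq
  have hwi : w' i = ⟨w i, hi⟩ := by simp [hw', hi]
  rw [withFirstColumn_apply_zero_zero, withFirstColumn_apply_one_zero, hwi]
  simp only [hw, mulFirstColumn, Matrix.SpecialLinearGroup.coe_mul, Matrix.mul_apply,
    Fin.sum_univ_two, Matrix.smul_apply, smul_eq_mul]
  ring

/-- The image of a singular `T` lies in one line, so the limit direction does not depend on `A`. -/
theorem mulFirstColumn_cross {T : Matrix (Fin 2) (Fin 2) ℝ} (hT : T.det = 0) (A A' : SL(2, ℝ)) :
    mulFirstColumn T A 0 * mulFirstColumn T A' 1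
      = mulFirstColumn T A 1 * mulFirstColumn T A' 0 := by
  rw [Matrix.det_fin_two] at hT
  simp only [mulFirstColumn]
  linear_combination (A 0 0 * A' 1 0 - A 1 0 * A' 0 0) * hT

/-- The kernel of a nonzero `T` is at most a line: only one point of the projective line is
exceptional. -/
theorem cross_eq_of_mulFirstColumn_eq_zero {T : Matrix (Fin 2) (Fin 2) ℝ} (hT : T ≠ 0)
    {A A' : SL(2, ℝ)} (h : mulFirstColumn T A = 0) (h' : mulFirstColumn T A' = 0) :
    A 0 0 * A' 1 0 = A 1 0 * A' 0 0 := by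
  by_contra hc
  refine hT ?_
  have key : ∀ i, T i 0 = 0 ∧ T i 1 = 0 := by
    intro i
    have e := congrFun h i
    have e' := congrFun h' i
    simp only [mulFirstColumn, Pi.zero_apply] at e e'
    have hd : A 0 0 * A' 1 0 - A 1 0 * A' 0 0 ≠ 0 := sub_ne_zero.mpr hc
    constructor
    · refine (mul_eq_zero.mp ?_).resolve_left hd
      linear_combination A' 1 0 * e - A 1 0 * e'
    · refine (mul_eq_zero.mp ?_).resolve_left hd
      linear_combination A 0 0 * e' - A' 0 0 * e
  ext i j
  fin_cases j
  · exact (key i).1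
  · exact (key i).2

theorem cross_eq_of_toPSL_coset_eq {A A' : SL(2, ℝ)}
    (h : (toPSL A : PSL(2, ℝ) ⧸ borelPSL) = toPSL A') : A 0 0 * A' 1 0 = A 1 0 * A' 0 0 := by
  rw [QuotientGroup.eq, ← map_inv, ← map_mul] at h
  obtain ⟨N, ⟨l, t, -, hN⟩, hNA⟩ := h
  obtain ⟨r, -, hr⟩ := Matrix.SpecialLinearGroup.mem_center_iff.mp (QuotientGroup.eq.mp hNA)
  have hA' : A' = A * N * (N⁻¹ * (A⁻¹ * A')) := by group
  have hval : (A' : Matrix (Fin 2) (Fin 2) ℝ) = A * N * Matrix.scalar (Fin 2) r := by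
    rw [hr, ← Matrix.SpecialLinearGroup.coe_mul, ← Matrix.SpecialLinearGroup.coe_mul, ← hA']
  have h0 : A' 0 0 = A 0 0 * l * r := by
    rw [hval, hN]; simp [Matrix.mul_apply, Fin.sum_univ_two]
  have h1 : A' 1 0 = A 1 0 * l * r := by
    rw [hval, hN]; simp [Matrix.mul_apply, Fin.sum_univ_two]
  rw [h0, h1]
  ring

/-- Under a minimal action this excludes global fixed points. -/
theorem not_dense_singleton (ξ : PSL(2, ℝ) ⧸ borelPSL) : ¬ Dense {ξ} := by
  intro hd
  obtain ⟨q, rfl⟩ := QuotientGroup.mk_surjective ξ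
  obtain ⟨A, rfl⟩ := toPSL_surjective q
  have hd' : Dense ((fun A' : SL(2, ℝ) => (toPSL A' : PSL(2, ℝ) ⧸ borelPSL)) ⁻¹'
      {(toPSL A : PSL(2, ℝ) ⧸ borelPSL)}) :=
    hd.preimage (QuotientGroup.isOpenMap_coe.comp QuotientGroup.isOpenMap_coe)
  have hent : ∀ i j, Continuous fun A' : SL(2, ℝ) => A' i j := fun i j =>
    continuous_subtype_val.matrix_elem i j
  have ho : IsOpen {A' : SL(2, ℝ) | A 0 0 * A' 1 0 ≠ A 1 0 * A' 0 0} :=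
    isOpen_ne_fun ((hent 1 0).const_mul _) ((hent 0 0).const_mul _)
  have hdet := A.det_coe
  rw [Matrix.det_fin_two] at hdet
  have hne : {A' : SL(2, ℝ) | A 0 0 * A' 1 0 ≠ A 1 0 * A' 0 0}.Nonempty := by
    -- The second column of `A` becomes the first: it is not parallel to the first column of `A`.
    refine ⟨⟨!![A 0 1, -(A 0 0); A 1 1, -(A 1 0)], ?_⟩, ?_⟩
    · rw [Matrix.det_fin_two_of]
      linarith
    · change A 0 0 * A 1 1 ≠ A 1 0 * A 0 1
      intro h
      linarith
  obtain ⟨A', hA', hA'A⟩ := hd'.inter_open_nonempty _ ho hne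
  exact hA' (cross_eq_of_toPSL_coset_eq (Eq.symm hA'A))

end ProjectiveLine

/-! ### Divergence in `SL(2, ℝ)` and in `Γ` -/

section Divergence

open scoped Matrix.Norms.Elementwise

/-- A sequence in `SL(2, ℝ)` either has a limit along an ultrafilter, or, once normalised,
converges to a matrix of rank one. -/
theorem Ultrafilter.exists_tendsto_or_tendsto_smul {ι : Type*} (U : Ultrafilter ι)
    (F : ι → SL(2, ℝ)) : (∃ A, Tendsto F U (𝓝 A)) ∨ ∃ (c : ι → ℝ) (T : Matrix (Fin 2) (Fin 2) ℝ),
      T ≠ 0 ∧ T.det = 0 ∧ Tendsto (fun i => c i • (F i : Matrix _ _ ℝ)) U (𝓝 T) := by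
  by_cases hb : ∃ R : ℝ, ∀ᶠ i in U, ‖(F i : Matrix (Fin 2) (Fin 2) ℝ)‖ ≤ R
  · left
    obtain ⟨R, hR⟩ := hb
    have hK : IsCompact (((↑) : SL(2, ℝ) → Matrix (Fin 2) (Fin 2) ℝ) ⁻¹'
        Metric.closedBall 0 R) :=
      Matrix.SpecialLinearGroup.isClosedEmbedding_val.isCompact_preimage
        (isCompact_closedBall 0 R)
    obtain ⟨A, -, hA⟩ := hK.ultrafilter_le_nhds (U.map F) (by
      refine le_principal_iff.mpr (mem_map.mpr ?_)
      filter_upwards [hR] with i hi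
      exact mem_closedBall_zero_iff.mpr hi)
    exact ⟨A, hA⟩
  · right
    -- Along an ultrafilter, a norm that is not eventually bounded tends to infinity.
    push Not at hb
    have hinf : Tendsto (fun i => ‖(F i : Matrix (Fin 2) (Fin 2) ℝ)‖) U atTop := by
      refine tendsto_atTop.mpr fun R => ?_
      exact (hb R).mono fun i hi => hi.le
    set c : ι → ℝ := fun i => ‖(F i : Matrix (Fin 2) (Fin 2) ℝ)‖⁻¹ with hc
    have hsph : ∀ i, c i • (F i : Matrix (Fin 2) (Fin 2) ℝ) ∈
        Metric.sphere (0 : Matrix (Fin 2) (Fin 2) ℝ) 1 := by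
      intro i
      have hne : (F i : Matrix (Fin 2) (Fin 2) ℝ) ≠ 0 := by
        intro h0
        have := (F i).det_coe
        rw [h0] at this
        simp at this
      rw [mem_sphere_zero_iff_norm, norm_smul, hc, norm_inv, norm_norm]
      exact inv_mul_cancel₀ (norm_ne_zero_iff.mpr hne)
    obtain ⟨T, hTs, hT⟩ := (isCompact_sphere (0 : Matrix (Fin 2) (Fin 2) ℝ) 1).ultrafilter_le_nhds
      (U.map fun i => c i • (F i : Matrix (Fin 2) (Fin 2) ℝ))
      (le_principal_iff.mpr (mem_map.mpr (univ_mem' hsph)))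
    have hT' : Tendsto (fun i => c i • (F i : Matrix (Fin 2) (Fin 2) ℝ)) U (𝓝 T) := hT
    refine ⟨c, T, ?_, ?_, hT'⟩
    · rintro rfl
      simp at hTs
    · have h1 : Tendsto (fun i => (c i • (F i : Matrix (Fin 2) (Fin 2) ℝ)).det) U (𝓝 T.det) :=
        ((continuous_id.matrix_det).tendsto T).comp hT'
      have h2 : Tendsto (fun i => (c i • (F i : Matrix (Fin 2) (Fin 2) ℝ)).det) U (𝓝 0) := by
        -- The determinant of `c i • F i` is `c i ^ 2`.
        have : Tendsto (fun i => c i ^ 2) U (𝓝 0) := by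
          simpa [hc] using (tendsto_inv_atTop_zero.comp hinf).pow 2
        refine this.congr fun i => ?_
        rw [Matrix.det_smul, (F i).det_coe]
        simp
      exact tendsto_nhds_unique h1 h2

end Divergence

/-- Without isolated points, a dense set stays dense after removing finitely many points, so
infinitely many elements of `Γ` lie over each neighbourhood of 1. -/
theorem exists_ultrafilter_tendsto_snd {K G : Type*} [Group K] [Group G] [TopologicalSpace G]
    [T1Space G] [∀ x : G, (𝓝[≠] x).NeBot] (Γ : Subgroup (K × G))
    (hd : Dense (Γ.map (MonoidHom.snd K G) : Set G)) :
    ∃ U : Ultrafilter Γ, (U : Filter Γ) ≤ cofinite ∧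
      Tendsto (fun γ : Γ => (γ : K × G).2) U (𝓝 1) := by
  have : (comap (fun γ : Γ => (γ : K × G).2) (𝓝 1) ⊓ cofinite).NeBot := by
    rw [((𝓝 (1 : G)).basis_sets.comap _).inf_basis_neBot_iff hasBasis_cofinite]
    intro V hV S hS
    obtain ⟨x, ⟨⟨γ, hγ, rfl⟩, hγS⟩, hγV⟩ :=
      (hd.sdiff_finite (hS.image fun γ : Γ => (γ : K × G).2)).inter_nhds_nonempty hV
    exact ⟨⟨γ, hγ⟩, hγV, fun h => hγS ⟨_, h, rfl⟩⟩
  obtain ⟨U, hU⟩ := Ultrafilter.exists_le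
    (comap (fun γ : Γ => (γ : K × G).2) (𝓝 1) ⊓ cofinite)
  exact ⟨U, hU.trans inf_le_right, tendsto_iff_comap.mpr (hU.trans inf_le_left)⟩

theorem exists_smul_ne_of_isMinimal {K G : Type*} [Group K] [Group G]
    {Γ : Subgroup (K × G)} {α : Type*} [TopologicalSpace α] [MulAction K α] (h : MulAction.IsMinimal (Γ.map (MonoidHom.fst K G)) α)
    {ξ : α} (hξ : ¬ Dense {ξ}) : ∃ γ ∈ Γ, γ.1 • ξ ≠ ξ := by
  by_contra! hfix
  refine hξ ((h.dense_orbit ξ).mono ?_)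
  rintro _ ⟨⟨_, γ, hγ, rfl⟩, rfl⟩
  exact hfix γ hγ

/-- `Γ` permutes full fibres, so `D` contains those over a dense subset of `PSL(2, ℝ)/B`. -/
theorem eq_univ_of_forall_mem {G : Type*} [Group G] [TopologicalSpace G]
    {Γ : Subgroup (PSL(2, ℝ) × G)}
    (hmin : MulAction.IsMinimal (Γ.map (MonoidHom.fst PSL(2, ℝ) G)) (PSL(2, ℝ) ⧸ borelPSL))
    {D : Set (PSL(2, ℝ) × G)} (hDc : IsClosed D) (hDΓ : ∀ γ ∈ Γ, ∀ p ∈ D, γ * p ∈ D)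
    (hDB : ∀ p ∈ D, ∀ b ∈ borelPSL, (p.1 * b, p.2) ∈ D) {q : PSL(2, ℝ)}
    (hq : ∀ g, (q, g) ∈ D) : D = Set.univ := by
  refine Set.eq_univ_of_forall fun ⟨r, g⟩ => ?_
  have hd := (hmin.dense_orbit (q : PSL(2, ℝ) ⧸ borelPSL)).preimage QuotientGroup.isOpenMap_coe
  have hc : IsClosed {r : PSL(2, ℝ) | (r, g) ∈ D} := hDc.preimage (by fun_prop)
  refine (hc.closure_subset_iff.mpr ?_) (hd r)
  rintro r' ⟨⟨_, γ, hγ, rfl⟩, hr'⟩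
  have hb : (γ.1 * q)⁻¹ * r' ∈ borelPSL := QuotientGroup.eq.mp hr'
  have := hDB _ (hDΓ γ hγ _ (hq (γ.2⁻¹ * g))) _ hb
  rwa [Prod.mk_mul_mk, mul_inv_cancel_left, mul_inv_cancel_left] at this

/-! ### Closed sets invariant under `Γ` and `B` -/

section Minimality

variable {G : Type*} [Group G] [TopologicalSpace G] [IsTopologicalGroup G]

theorem exists_tendsto_smul_of_discreteTopology [T1Space G] [∀ x : G, (𝓝[≠] x).NeBot]
    (Γ : Subgroup (PSL(2, ℝ) × G)) [DiscreteTopology Γ]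
    (hd : Dense (Γ.map (MonoidHom.snd PSL(2, ℝ) G) : Set G)) :
    ∃ (U : Ultrafilter Γ) (F : Γ → SL(2, ℝ)) (c : Γ → ℝ) (T : Matrix (Fin 2) (Fin 2) ℝ),
      Tendsto (fun γ : Γ => (γ : PSL(2, ℝ) × G).2) U (𝓝 1) ∧
      (∀ γ : Γ, toPSL (F γ) = (γ : PSL(2, ℝ) × G).1) ∧ T ≠ 0 ∧ T.det = 0 ∧
      Tendsto (fun γ => c γ • (F γ : Matrix _ _ ℝ)) U (𝓝 T) := by
  obtain ⟨U, hU, hU1⟩ := exists_ultrafilter_tendsto_snd Γ hd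
  choose F hF using fun γ : Γ => toPSL_surjective (γ : PSL(2, ℝ) × G).1
  rcases U.exists_tendsto_or_tendsto_smul F with ⟨A, hA⟩ | ⟨c, T, hT, hdet, hlim⟩
  · refine absurd ?_ (Γ.not_tendsto_of_discreteTopology hU (toPSL A, 1))
    have h1 : Tendsto (fun γ : Γ => (γ : PSL(2, ℝ) × G).1) U (𝓝 (toPSL A)) :=
      ((continuous_toPSL.tendsto A).comp hA).congr hF
    exact h1.prodMk_nhds hU1
  · exact ⟨U, F, c, T, hU1, hF, hT, hdet, hlim⟩

theorem eq_univ_of_isMinimal_of_dense [T1Space G] [ConnectedSpace G]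
    (Γ : Subgroup (PSL(2, ℝ) × G)) [DiscreteTopology Γ]
    (hmin : MulAction.IsMinimal (Γ.map (MonoidHom.fst PSL(2, ℝ) G)) (PSL(2, ℝ) ⧸ borelPSL))
    (hd : Dense (Γ.map (MonoidHom.snd PSL(2, ℝ) G) : Set G))
    {D : Set (PSL(2, ℝ) × G)} (hDc : IsClosed D) (hDΓ : ∀ γ ∈ Γ, ∀ p ∈ D, γ * p ∈ D)
    (hDB : ∀ p ∈ D, ∀ b ∈ borelPSL, (p.1 * b, p.2) ∈ D) (hne : D.Nonempty) : D = Set.univ := by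
  obtain ⟨⟨q, x⟩, hqx⟩ := hne
  -- For trivial `G` the point 1 is isolated, but one point of `D` is already a full fibre.
  rcases subsingleton_or_nontrivial G with hG | hG
  · exact eq_univ_of_forall_mem hmin hDc hDΓ hDB (q := q) fun g => Subsingleton.elim x g ▸ hqx
  have hDB' : ∀ {r r' : PSL(2, ℝ)} {y : G}, (r, y) ∈ D →
      (r : PSL(2, ℝ) ⧸ borelPSL) = r' → (r', y) ∈ D := fun {r r' y} hr h => by
    simpa using hDB _ hr _ (QuotientGroup.eq.mp h)
  obtain ⟨U, F, c, T, hU, hF, hT, hdet, hlim⟩ := exists_tendsto_smul_of_discreteTopology Γ hd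
  set Z : Set (PSL(2, ℝ) ⧸ borelPSL) :=
    {ξ | ∃ A : SL(2, ℝ), ξ = toPSL A ∧ mulFirstColumn T A = 0} with hZdef
  have hZ : Z.Subsingleton := by
    rintro _ ⟨A, rfl, hA⟩ _ ⟨A', rfl, hA'⟩
    exact toPSL_coset_eq (cross_eq_of_mulFirstColumn_eq_zero hT hA hA')
  have hpos : ∀ A : SL(2, ℝ), (toPSL A : PSL(2, ℝ) ⧸ borelPSL) ∉ Z →
      0 < mulFirstColumn T A 0 ^ 2 + mulFirstColumn T A 1 ^ 2 := by
    intro A hA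
    by_contra hc
    refine hA ⟨A, rfl, ?_⟩
    ext i
    fin_cases i <;> simp <;>
      nlinarith [sq_nonneg (mulFirstColumn T A 0), sq_nonneg (mulFirstColumn T A 1)]
  have hS := Subgroup.dense_snd_of_smul_notMem hd hZ
    (exists_smul_ne_of_isMinimal hmin (not_dense_singleton (q : PSL(2, ℝ) ⧸ borelPSL)))
  set S := {k : G | ∃ f : PSL(2, ℝ), (f, k) ∈ Γ ∧ f • (q : PSL(2, ℝ) ⧸ borelPSL) ∉ Z} with hSdef
  have hlift : ∀ k ∈ S, ∃ A : SL(2, ℝ), (toPSL A, k * x) ∈ D ∧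
      0 < mulFirstColumn T A 0 ^ 2 + mulFirstColumn T A 1 ^ 2 := by
    rintro k ⟨f, hfk, hf⟩
    obtain ⟨A, hA⟩ := toPSL_surjective (f * q)
    refine ⟨A, hA ▸ hDΓ _ hfk _ hqx, hpos A ?_⟩
    rw [hA]
    exact hf
  -- `A₀` serves only to name the point `im T` independently of `k`.
  obtain ⟨k₀, hk₀⟩ := hS.nonempty
  obtain ⟨A₀, -, hA₀⟩ := hlift k₀ hk₀
  have hcol : ∀ k ∈ S, (toPSL (withFirstColumn ⟨_, hA₀⟩), k * x) ∈ D := by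
    intro k hk
    obtain ⟨A, hAD, hA⟩ := hlift k hk
    obtain ⟨P, hP, hPF⟩ := exists_tendsto_toPSL hlim A hA
    have htend : Tendsto (fun γ : Γ => (toPSL (P γ), (γ : PSL(2, ℝ) × G).2 * (k * x))) U
        (𝓝 (toPSL (withFirstColumn ⟨_, hA⟩), k * x)) := by
      refine ((continuous_toPSL.tendsto _).comp hP).prodMk_nhds ?_
      simpa using hU.mul_const (k * x)
    have hmem : (toPSL (withFirstColumn ⟨_, hA⟩), k * x) ∈ D := by
      refine hDc.mem_of_tendsto htend (hPF.mono fun γ hγ => ?_)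
      refine hDB' (hDΓ γ γ.2 _ hAD) (hγ.trans ?_).symm
      rw [map_mul, hF]
    refine hDB' hmem (toPSL_coset_eq ?_)
    exact mulFirstColumn_cross hdet A A₀
  refine eq_univ_of_forall_mem hmin hDc hDΓ hDB (q := toPSL (withFirstColumn ⟨_, hA₀⟩)) fun g => ?_
  have hc : IsClosed {k : G | (toPSL (withFirstColumn ⟨_, hA₀⟩), k * x) ∈ D} :=
    hDc.preimage (by fun_prop)
  have := hc.closure_subset_iff.mpr hcol (hS (g * x⁻¹))
  simpa using this

end Minimality

/-! ### Passage between `X` and `H` -/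

namespace LeftQuot

variable {G : Type*} [Group G] {Γ : Subgroup (PSL(2, ℝ) × G)}

theorem mk_eq_mk_iff {p h : PSL(2, ℝ) × G} : mk Γ p = mk Γ h ↔ ∃ γ ∈ Γ, p = γ * h := by
  refine Quotient.eq.trans (QuotientGroup.rightRel_apply.trans ⟨fun hp => ?_, ?_⟩)
  · exact ⟨(h * p⁻¹)⁻¹, Γ.inv_mem hp, by group⟩
  · rintro ⟨γ, hγ, rfl⟩
    simpa using hγ

theorem mk_mem_orbit_op_iff {F : Subgroup PSL(2, ℝ)} {p h : PSL(2, ℝ) × G} :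
    mk Γ p ∈ MulAction.orbit F.op (mk Γ h) ↔
      ∃ γ ∈ Γ, ∃ b ∈ F, p = (γ.1 * h.1 * b, γ.2 * h.2) := by
  constructor
  · rintro ⟨⟨b, hb⟩, hbp⟩
    obtain ⟨γ, hγ, rfl⟩ := mk_eq_mk_iff.mp (Eq.symm hbp)
    exact ⟨γ, hγ, b.unop, hb, Prod.ext (mul_assoc _ _ _).symm rfl⟩
  · rintro ⟨γ, hγ, b, hb, rfl⟩
    refine ⟨⟨MulOpposite.op b, hb⟩, (mk_eq_mk_iff.mpr ⟨γ, hγ, ?_⟩).symm⟩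
    exact Prod.ext (mul_assoc _ _ _) rfl

theorem mk_mem_orbit_iff {p h : PSL(2, ℝ) × G} :
    mk Γ p ∈ MulAction.orbit PSL(2, ℝ)ᵐᵒᵖ (mk Γ h) ↔ ∃ γ ∈ Γ, p.2 = γ.2 * h.2 := by
  constructor
  · rintro ⟨b, hbp⟩
    obtain ⟨γ, hγ, rfl⟩ := mk_eq_mk_iff.mp (Eq.symm hbp)
    exact ⟨γ, hγ, rfl⟩
  · rintro ⟨γ, hγ, hp⟩
    refine ⟨MulOpposite.op (h.1⁻¹ * γ.1⁻¹ * p.1), (mk_eq_mk_iff.mpr ⟨γ, hγ, ?_⟩).symm⟩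
    exact Prod.ext (by simp [mul_assoc]) hp

theorem mk_surjective : Function.Surjective (mk Γ) := Quotient.mk_surjective

variable [TopologicalSpace G]

theorem continuous_mk : Continuous (mk Γ) := continuous_quot_mk

/-- The quotient map is continuous, surjective and open, so orbit closures can be studied upstairs
in `H`. -/
theorem dense_preimage_mk_iff [IsTopologicalGroup G] {S : Set (LeftQuot Γ)} :
    Dense (mk Γ ⁻¹' S) ↔ Dense S := by
  refine ⟨fun h => ?_, fun h => h.preimage ?_⟩
  · have := (mk_surjective (Γ := Γ)).denseRange.dense_image continuous_mk h
    rwa [Set.image_preimage_eq _ mk_surjective] at this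
  · exact isOpenMap_quotient_mk'_mul (Γ := Γ) (T := PSL(2, ℝ) × G)

theorem isMinimal_op_iff [IsTopologicalGroup G] {F : Subgroup PSL(2, ℝ)} :
    MulAction.IsMinimal F.op (LeftQuot Γ) ↔ ∀ h : PSL(2, ℝ) × G,
      Dense {p : PSL(2, ℝ) × G | ∃ γ ∈ Γ, ∃ b ∈ F, p = (γ.1 * h.1 * b, γ.2 * h.2)} := by
  have key : ∀ h : PSL(2, ℝ) × G, Dense (MulAction.orbit F.op (mk Γ h)) ↔
      Dense {p : PSL(2, ℝ) × G | ∃ γ ∈ Γ, ∃ b ∈ F, p = (γ.1 * h.1 * b, γ.2 * h.2)} := by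
    intro h
    rw [← dense_preimage_mk_iff]
    exact iff_of_eq (congrArg Dense (Set.ext fun p => mk_mem_orbit_op_iff))
  refine ⟨fun hm h => (key h).mp (hm.dense_orbit _), fun hm => ⟨fun x => ?_⟩⟩
  obtain ⟨h, rfl⟩ := mk_surjective x
  exact (key h).mpr (hm h)

theorem isMinimal_iff_dense_map_snd [IsTopologicalGroup G] :
    MulAction.IsMinimal PSL(2, ℝ)ᵐᵒᵖ (LeftQuot Γ) ↔
      Dense (Γ.map (MonoidHom.snd PSL(2, ℝ) G) : Set G) := by
  have key : ∀ h : PSL(2, ℝ) × G, Dense (MulAction.orbit PSL(2, ℝ)ᵐᵒᵖ (mk Γ h)) ↔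
      Dense {p : PSL(2, ℝ) × G | ∃ γ ∈ Γ, p.2 = γ.2 * h.2} := by
    intro h
    rw [← dense_preimage_mk_iff]
    exact iff_of_eq (congrArg Dense (Set.ext fun p => mk_mem_orbit_iff))
  constructor
  · intro hm
    have hd := (key 1).mp (hm.dense_orbit _)
    refine (Prod.snd_surjective.denseRange.dense_image continuous_snd hd).mono ?_
    rintro _ ⟨p, ⟨γ, hγ, hp⟩, rfl⟩
    exact ⟨γ, hγ, by simpa using hp.symm⟩
  · refine fun hd => ⟨fun x => ?_⟩
    obtain ⟨h, rfl⟩ := mk_surjective x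
    refine (key h).mpr ?_
    have := hd.preimage ((Homeomorph.mulRight h.2⁻¹).isOpenMap.comp
      (isOpenMap_snd (X := PSL(2, ℝ)) (Y := G)))
    refine this.mono ?_
    rintro p ⟨γ, hγ, hp⟩
    refine ⟨γ, hγ, ?_⟩
    have hp' : γ.2 = p.2 * h.2⁻¹ := hp
    rw [hp', inv_mul_cancel_right]

theorem isMinimal_borelPSL_iff [IsTopologicalGroup G] [T1Space G] [ConnectedSpace G]
    [DiscreteTopology Γ] : MulAction.IsMinimal borelPSL.op (LeftQuot Γ) ↔
      MulAction.IsMinimal (Γ.map (MonoidHom.fst PSL(2, ℝ) G)) (PSL(2, ℝ) ⧸ borelPSL) ∧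
        Dense (Γ.map (MonoidHom.snd PSL(2, ℝ) G) : Set G) := by
  rw [isMinimal_op_iff]
  refine ⟨fun hm => ⟨⟨fun ξ => ?_⟩, ?_⟩, fun ⟨hmin, hd⟩ h => ?_⟩
  · obtain ⟨q, rfl⟩ := QuotientGroup.mk_surjective ξ
    have hsurj : Function.Surjective fun p : PSL(2, ℝ) × G => (p.1 : PSL(2, ℝ) ⧸ borelPSL) :=
      QuotientGroup.mk_surjective.comp Prod.fst_surjective
    refine (hsurj.denseRange.dense_image
      (QuotientGroup.continuous_mk.comp continuous_fst) (hm (q, 1))).mono ?_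
    rintro _ ⟨_, ⟨γ, hγ, b, hb, rfl⟩, rfl⟩
    refine ⟨⟨γ.1, γ, hγ, rfl⟩, ?_⟩
    exact (QuotientGroup.mk_mul_of_mem (γ.1 * q) hb).symm
  · refine (Prod.snd_surjective.denseRange.dense_image continuous_snd (hm 1)).mono ?_
    rintro _ ⟨_, ⟨γ, hγ, b, hb, rfl⟩, rfl⟩
    exact ⟨γ, hγ, by simp⟩
  · rw [dense_iff_closure_eq]
    -- Here `D` is the closure of `Γ h B`.
    refine eq_univ_of_isMinimal_of_dense Γ hmin hd isClosed_closure ?_ ?_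
      ⟨h, subset_closure ⟨1, Γ.one_mem, 1, borelPSL.one_mem, by simp⟩⟩
    · intro γ hγ p hp
      refine map_mem_closure (continuous_const_mul γ) hp ?_
      rintro _ ⟨δ, hδ, b, hb, rfl⟩
      exact ⟨γ * δ, Γ.mul_mem hγ hδ, b, hb, Prod.ext (by simp [mul_assoc]) (by simp [mul_assoc])⟩
    · intro p hp b hb
      refine map_mem_closure (f := fun p : PSL(2, ℝ) × G => (p.1 * b, p.2)) (by fun_prop) hp ?_
      rintro _ ⟨δ, hδ, b', hb', rfl⟩
      exact ⟨δ, hδ, b' * b, borelPSL.mul_mem hb' hb, Prod.ext (by simp [mul_assoc]) rfl⟩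

end LeftQuot

theorem proposition2p1 {E : Type*} [NormedAddCommGroup E] [NormedSpace ℝ E]
    [FiniteDimensional ℝ E] {G : Type*} [Group G] [TopologicalSpace G] [T2Space G]
    [SecondCountableTopology G] [ChartedSpace E G] [LieGroup 𝓘(ℝ, E) ∞ G] [ConnectedSpace G]
    (Γ : Subgroup (PSL(2, ℝ) × G)) [DiscreteTopology Γ] :
    (MulAction.IsMinimal borelPSL.op (LeftQuot Γ) ↔
      MulAction.IsMinimal (Γ.map (MonoidHom.fst PSL(2, ℝ) G)) (PSL(2, ℝ) ⧸ borelPSL) ∧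
        Dense (Γ.map (MonoidHom.snd PSL(2, ℝ) G) : Set G)) ∧
    (Dense (Γ.map (MonoidHom.snd PSL(2, ℝ) G) : Set G) ↔
      MulAction.IsMinimal PSL(2, ℝ)ᵐᵒᵖ (LeftQuot Γ)) := by
  have : IsTopologicalGroup G := topologicalGroup_of_lieGroup 𝓘(ℝ, E) ∞
  exact ⟨LeftQuot.isMinimal_borelPSL_iff, LeftQuot.isMinimal_iff_dense_map_snd.symm⟩
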